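/- Let $d_l,d_r\ge 1$, let $U\subset\mathbb R^{d_l}\times\mathbb R^{d_r}$ be open, let $\rho:U\to\mathbb R$ be smooth, let $E\subset U$ be (relatively) closed, let $w$ be a real-valued measurable function on $U$, and let $s>0$. Write $U_x=\{y:(x,y)\in U\}$, $E^y=\{x:(x,y)\in E\}$, $|Q|=|\det Q|$, $|\cdot|$ for the Euclidean norm of a vector and for the Lebesgue measure of a set, and let $|\rho(E)|_L:=\operatorname{ess\,sup}_{y}|\rho(E^y)|$, where $\rho(E^y)=\{\rho(x,y):x\in E^y\}$. Suppose that $K_E<\infty$ satisfies $$\sup_{x\in\mathbb R^{d_l}}\ \sup_{Q\in GL(d_l,\mathbb R)}|Q|^{\frac s{d_l}}\int_{U_x}\frac{|w(x,y)|\,\chi_E(x,y)}{|Q\,\partial_x\rho(x,y)|^s}\,dy\le K_E ,$$ where the integrand is $0$ where its numerator vanishes and $+\infty$ where only its denominator vanishes. With $$\Sigma_y^{L,c}:=\{x\in\mathbb R^{d_l}:(x,y)\in U,\ \rho(x,y)=c,\ \partial_x\rho(x,y)\neq0\},$$ suppose further that $N_L$ is a nonnegative integer such that for all $y_1,\dots,y_{d_l}\in\mathbb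 R^{d_r}$ and all $c_1,\dots,c_{d_l}\in\rho(E)$, $$\#\{x\in\Sigma_{y_1}^{L,c_1}\cap\cdots\cap\Sigma_{y_{d_l}}^{L,c_{d_l}}:\ \det(\partial_x\rho(x,y_1),\dots,\partial_x\rho(x,y_{d_l}))\neq0\}\le N_L .$$ Then for all measurable $f$ on $\mathbb R^{d_l}$ and $g$ on $\mathbb R^{d_r}$, $$\int_E|w(x,y)|^{\frac1{s+1}}|f(x)g(y)|\,dx\,dy\le C_{d_l}N_L^{\frac{s}{d_l(s+1)}}\,K_E^{\frac1{s+1}}\,|\rho(E)|_L^{\frac s{s+1}}\,\|f\|_{L^{p'}}\,\|g\|_{L^{\frac{s+1}s}},\qquad \frac1{p'}=1-\frac1{d_l}\frac s{s+1},$$ where $C_{d_l}$ depends only on $d_l$. (Both sides are elements of $[0,\infty]$, with the convention $0\cdot\infty=0$.) -/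

import Mathlib

open MeasureTheory
open scoped ENNReal NNReal ContDiff

/-- The Euclidean gradient `∂ₓρ(x, y)` in the first group of variables. -/
noncomputable def gradX {dl dr : ℕ}
    (ρ : EuclideanSpace ℝ (Fin dl) × EuclideanSpace ℝ (Fin dr) → ℝ)
    (x : EuclideanSpace ℝ (Fin dl)) (y : EuclideanSpace ℝ (Fin dr)) :
    EuclideanSpace ℝ (Fin dl) :=
  gradient (fun x' => ρ (x', y)) x

/-- The supremum over `x ∈ ℝ^dl` and `Q ∈ GL(dl, ℝ)` of
`|det Q|^(s/dl) ∫_{U_x} |w(x,y)| χ_E(x,y) / |Q ∂ₓρ(x,y)|^s dy`, as an extended nonnegative number.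
(In `ℝ≥0∞`, `a / 0 = ∞` for `a ≠ 0` and `0 / 0 = 0`.) -/
noncomputable def geometricSup {dl dr : ℕ}
    (U : Set (EuclideanSpace ℝ (Fin dl) × EuclideanSpace ℝ (Fin dr)))
    (ρ : EuclideanSpace ℝ (Fin dl) × EuclideanSpace ℝ (Fin dr) → ℝ)
    (E : Set (EuclideanSpace ℝ (Fin dl) × EuclideanSpace ℝ (Fin dr)))
    (w : EuclideanSpace ℝ (Fin dl) × EuclideanSpace ℝ (Fin dr) → ℝ) (s : ℝ) : ℝ≥0∞ :=
  ⨆ (x : EuclideanSpace ℝ (Fin dl)) (Q : Matrix.GeneralLinearGroup (Fin dl) ℝ),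
    ‖(Q : Matrix (Fin dl) (Fin dl) ℝ).det‖ₑ ^ (s / (dl : ℝ)) *
      ∫⁻ y in {y | (x, y) ∈ U},
        (‖w (x, y)‖ₑ * E.indicator (fun _ => (1 : ℝ≥0∞)) (x, y)) /
          ‖Matrix.toEuclideanLin (Q : Matrix (Fin dl) (Fin dl) ℝ) (gradX ρ x y)‖ₑ ^ s

/-- The left width `|ρ(E)|_L = ess sup_y |ρ(E^y)|`, where `E^y = {x | (x, y) ∈ E}`. -/
noncomputable def leftWidth {dl dr : ℕ}
    (ρ : EuclideanSpace ℝ (Fin dl) × EuclideanSpace ℝ (Fin dr) → ℝ)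
    (E : Set (EuclideanSpace ℝ (Fin dl) × EuclideanSpace ℝ (Fin dr))) : ℝ≥0∞ :=
  essSup (fun y : EuclideanSpace ℝ (Fin dr) =>
    (volume : Measure ℝ) ((fun x => ρ (x, y)) '' {x | (x, y) ∈ E})) volume

/-- The hypersurface
`Σ_y^{L,c} = {x | (x, y) ∈ U, ρ(x, y) = c, ∂ₓρ(x, y) ≠ 0}`. -/
def sigmaL {dl dr : ℕ}
    (U : Set (EuclideanSpace ℝ (Fin dl) × EuclideanSpace ℝ (Fin dr)))
    (ρ : EuclideanSpace ℝ (Fin dl) × EuclideanSpace ℝ (Fin dr) → ℝ)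
    (y : EuclideanSpace ℝ (Fin dr)) (c : ℝ) : Set (EuclideanSpace ℝ (Fin dl)) :=
  {x | (x, y) ∈ U ∧ ρ (x, y) = c ∧ gradX ρ x y ≠ 0}

/-- For all `y₁, …, y_dl` and all `c₁, …, c_dl ∈ ρ(E)`, the hypersurfaces `Σ_{y_i}^{L,c_i}` have at
most `N` transverse common points, i.e. common points at which the determinant with rows
`∂ₓρ(x, y₁), …, ∂ₓρ(x, y_dl)` does not vanish. -/
def TransverseBound {dl dr : ℕ}
    (U : Set (EuclideanSpace ℝ (Fin dl) × EuclideanSpace ℝ (Fin dr)))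
    (ρ : EuclideanSpace ℝ (Fin dl) × EuclideanSpace ℝ (Fin dr) → ℝ)
    (E : Set (EuclideanSpace ℝ (Fin dl) × EuclideanSpace ℝ (Fin dr))) (N : ℕ) : Prop :=
  ∀ (y : Fin dl → EuclideanSpace ℝ (Fin dr)) (c : Fin dl → ℝ), (∀ i, c i ∈ ρ '' E) →
    Set.encard {x | (x ∈ ⋂ i, sigmaL U ρ (y i) (c i)) ∧
      |(Matrix.of fun i j => gradX ρ x (y i) j).det| ≠ 0} ≤ (N : ℕ∞)

/-! Fix `x`, put `V(y) = χ_E ∂ₓρ(x,y)`, `W = χ_E |w|`, `G = |g|^((s+1)/s)`. For every invertible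
`Q`, Hölder with exponents `s+1` and `(s+1)/s` bounds `∫ W^(1/(s+1)) |g| dy` by `(∫
W/|QV|^s)^(1/(s+1)) (∫ G|QV|)^(s/(s+1))`, and the hypothesis bounds the first integral by `K |det
Q|^(-s/d)`.

The matrix `Q` is then chosen to have nearly maximal determinant among matrices whose rows `z`
satisfy `∫ |z·GV| ≤ 1`. Maximality says that `z ↦ det(Q with row j replaced by z)` is dominated by
`2|det Q| ∫ |z·GV|`. Feeding this into a determinant one row at a time gives `1 ≤ 2^d |det Q| D(x)`,
where `D(x)` integrates `|det(G(y_i)V(y_i))|` over `d`-tuples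
(`exists_matrix_lintegral_le_one_of_lintegral_det_lt`). Hence the inner integral is at most `2d
K^(1/(s+1)) D(x)^(s/(d(s+1)))` (`lintegral_le_mul_det_rpow`).

Hölder in `x` leaves `∫ D dx`. By Tonelli this is an average of `∫ |det(∂ₓρ(x,y_i))| dx`, where the
determinant is the Jacobian of `x ↦ (ρ(x,y_i))_i`. That map is at most `N`-to-one where the Jacobian
is nonzero, and its image lies in the box `∏ ρ(E^{y_i})` (`lintegral_det_gradX_le`). -/

/-! ### Area inequality with multiplicity -/

open Set Function in
/-- Area inequality with multiplicity: if all fibres of `f` in `s` have at most `N` points and the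
derivative is invertible on `s`, then `∫_s |det f'| ≤ N μ(f(s))`. -/
theorem lintegral_abs_det_fderiv_le_of_encard_fiber_le {E : Type*} [NormedAddCommGroup E]
    [NormedSpace ℝ E] [FiniteDimensional ℝ E] [MeasurableSpace E] [BorelSpace E]
    (μ : Measure E) [μ.IsAddHaarMeasure] {s : Set E} (hs : MeasurableSet s) {f : E → E}
    {f' : E → E →L[ℝ] E} (hf' : ∀ x ∈ s, HasFDerivWithinAt f (f' x) s x)
    (hdet : ∀ x ∈ s, (f' x).det ≠ 0) {N : ℕ}
    (hN : ∀ c ∈ f '' s, (s ∩ f ⁻¹' {c}).encard ≤ (N : ℕ∞)) :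
    ∫⁻ x in s, ENNReal.ofReal |(f' x).det| ∂μ ≤ N * μ (f '' s) := by
  classical
  -- Half the inverse norm of `A⁻¹` is a radius within which linear approximation by `A` forces
  -- injectivity. For singular `A` the radius 1 is a dummy.
  have hr : ∀ A : E →L[ℝ] E, ∃ r : ℝ≥0, r ≠ 0 ∧ (A.det ≠ 0 → ∀ t : Set E,
      ApproximatesLinearOn f A t r → InjOn f t) := by
    intro A
    by_cases hA : A.det = 0
    · exact ⟨1, one_ne_zero, fun h => absurd hA h⟩
    let e := A.toContinuousLinearEquivOfDetNeZero hA
    have he : (e : E →L[ℝ] E) = A := by ext; simp [e]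
    rcases subsingleton_or_nontrivial E with hE | hE
    · exact ⟨1, one_ne_zero, fun _ t _ x _ y _ _ => Subsingleton.elim x y⟩
    have hpos : 0 < ‖(e.symm : E →L[ℝ] E)‖₊⁻¹ := inv_pos.2 e.nnnorm_symm_pos
    refine ⟨‖(e.symm : E →L[ℝ] E)‖₊⁻¹ / 2, (half_pos hpos).ne', fun _ t ht => ?_⟩
    rw [← he] at ht
    exact ht.injOn (Or.inr (NNReal.half_lt_self hpos.ne'))
  choose r hr0 hrinj using hr
  obtain ⟨t, A, t_disj, t_meas, t_cover, ht, hA⟩ :=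
    exists_partition_approximatesLinearOn_of_hasFDerivWithinAt f s f' hf' r hr0
  rcases s.eq_empty_or_nonempty with rfl | hne
  · simp
  have hinj : ∀ n, InjOn f (s ∩ t n) := by
    intro n
    obtain ⟨y, ys, hy⟩ := hA hne n
    exact hrinj _ (hy ▸ hdet y ys) _ (ht n)
  have hm : ∀ n, MeasurableSet (s ∩ t n) := fun n => hs.inter (t_meas n)
  have hd : ∀ n, ∀ x ∈ s ∩ t n, HasFDerivWithinAt f (f' x) (s ∩ t n) x :=
    fun n x hx => (hf' x hx.1).mono inter_subset_left
  have him : ∀ n, MeasurableSet (f '' (s ∩ t n)) := fun n =>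
    measurable_image_of_fderivWithin (hm n) (hd n) (hinj n)
  have hU : s = ⋃ n, s ∩ t n := by
    rw [← inter_iUnion]; exact (inter_eq_left.2 t_cover).symm
  have hUim : f '' s = ⋃ n, f '' (s ∩ t n) := by rw [← image_iUnion, ← hU]
  have hfm : MeasurableSet (f '' s) := hUim ▸ MeasurableSet.iUnion him
  -- The pieces are disjoint, so distinct pieces whose image contains `c` supply distinct points of
  -- the fibre over `c`.
  have hcount : ∀ c, ∑' n, (f '' (s ∩ t n)).indicator (1 : E → ℝ≥0∞) c ≤
      (f '' s).indicator (fun _ => (N : ℝ≥0∞)) c := by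
    intro c
    by_cases hc : c ∈ f '' s
    · rw [indicator_of_mem hc]
      let T : Set ℕ := {n | c ∈ f '' (s ∩ t n)}
      have h1 : ∑' n, (f '' (s ∩ t n)).indicator (1 : E → ℝ≥0∞) c = ∑' _ : T, (1 : ℝ≥0∞) := by
        rw [tsum_subtype T (fun _ => (1 : ℝ≥0∞))]
        rfl
      rw [h1, ENNReal.tsum_set_one]
      have hex : ∀ n ∈ T, ∃ x, x ∈ s ∩ t n ∧ f x = c := fun n hn => hn
      choose! x hx using hex
      have hle : T.encard ≤ (s ∩ f ⁻¹' {c}).encard := by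
        refine encard_le_encard_of_injOn (f := x) (fun n hn => ⟨(hx n hn).1.1, (hx n hn).2⟩) ?_
        intro n hn m hm' hnm
        by_contra hne'
        exact disjoint_left.1 (t_disj hne') (hx n hn).1.2 (hnm ▸ (hx m hm').1.2)
      exact_mod_cast hle.trans (hN c hc)
    · rw [indicator_of_notMem hc]
      refine le_of_eq (ENNReal.tsum_eq_zero.2 fun n => indicator_of_notMem (fun h => hc ?_) _)
      exact image_mono inter_subset_left h
  calc ∫⁻ x in s, ENNReal.ofReal |(f' x).det| ∂μ
      ≤ ∑' n, ∫⁻ x in s ∩ t n, ENNReal.ofReal |(f' x).det| ∂μ := by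
        conv_lhs => rw [hU]
        exact lintegral_iUnion_le _ _
    _ = ∑' n, μ (f '' (s ∩ t n)) := by
        congr with n
        exact lintegral_abs_det_fderiv_eq_addHaar_image μ (hm n) (hd n) (hinj n)
    _ = ∑' n, ∫⁻ c, (f '' (s ∩ t n)).indicator (1 : E → ℝ≥0∞) c ∂μ := by
        congr with n
        rw [lintegral_indicator_one (him n)]
    _ = ∫⁻ c, ∑' n, (f '' (s ∩ t n)).indicator (1 : E → ℝ≥0∞) c ∂μ :=
        (lintegral_tsum fun n => (measurable_one.indicator (him n)).aemeasurable).symm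
    _ ≤ ∫⁻ c, (f '' s).indicator (fun _ => (N : ℝ≥0∞)) c ∂μ := lintegral_mono hcount
    _ = N * μ (f '' s) := by rw [lintegral_indicator_const hfm]

/-! ### Determinant functionals and nearly extremal matrices -/

theorem lintegral_pi_prod_eq_prod_lintegral {ι Y : Type*} [Fintype ι] [MeasurableSpace Y]
    (μ : Measure Y) [SigmaFinite μ] {f : Y → ℝ≥0∞} (hf : Measurable f) :
    ∫⁻ y : ι → Y, ∏ i, f (y i) ∂(Measure.pi fun _ => μ) = (∫⁻ y, f y ∂μ) ^ Fintype.card ι := by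
  classical
  rcases isEmpty_or_nonempty Y with hY | ⟨⟨y0⟩⟩
  · rcases isEmpty_or_nonempty ι with hι | hι <;> simp
  have hF : Measurable fun y : ι → Y => ∏ i, f (y i) :=
    Finset.measurable_prod _ fun i _ => hf.comp (measurable_pi_apply i)
  have key : ∀ (s : Finset ι) (x : ι → Y),
      (∫⋯∫⁻_s, (fun y : ι → Y => ∏ i, f (y i)) ∂fun _ => μ) x =
        (∫⁻ y, f y ∂μ) ^ s.card * ∏ i ∈ sᶜ, f (x i) := by
    intro s
    induction s using Finset.induction_on with
    | empty => intro x; simp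
    | insert i s hi ih =>
      intro x
      rw [lmarginal_insert _ hF hi]
      simp_rw [ih]
      have hc : sᶜ = insert i (insert i s)ᶜ := by
        ext j; by_cases hj : j = i <;> simp [hj, hi]
      have h1 : ∀ xi, ∏ j ∈ sᶜ, f (Function.update x i xi j) =
          f xi * ∏ j ∈ (insert i s)ᶜ, f (x j) := by
        intro xi
        rw [hc, Finset.prod_insert (by simp), Function.update_self]
        congr 1
        refine Finset.prod_congr rfl fun j hj => ?_
        rw [Function.update_of_ne]
        rintro rfl
        simp at hj
      simp_rw [h1]
      rw [lintegral_const_mul _ (hf.mul_const _), lintegral_mul_const _ hf,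
        Finset.card_insert_of_notMem hi, pow_succ, mul_assoc]
  rw [lintegral_eq_lmarginal_univ (fun _ => y0), key]
  simp

/-- If every functional at `a i` is controlled by its `L¹` norm along `v`, then
`|det a|` is controlled by the integral of the determinant functional of `v`. -/
theorem enorm_det_le_pow_mul_lintegral_det {ι Y : Type*} [Fintype ι] [DecidableEq ι]
    [MeasurableSpace Y] (μ : Measure Y) [SigmaFinite μ] {v : Y → ι → ℝ} (hv : Measurable v)
    (a : ι → ι → ℝ) (c : ℝ≥0∞)
    (H : ∀ (z : ι → ℝ) (j : ι), ‖z ⬝ᵥ a j‖ₑ ≤ c * ∫⁻ y, ‖z ⬝ᵥ v y‖ₑ ∂μ) :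
    ‖(Matrix.of a).det‖ₑ ≤ c ^ Fintype.card ι *
      ∫⁻ y : ι → Y, ‖(Matrix.of fun i => v (y i)).det‖ₑ ∂(Measure.pi fun _ => μ) := by
  let F : Finset ι → (ι → Y) → ℝ≥0∞ := fun s y =>
    ‖(Matrix.of fun i => if i ∈ s then v (y i) else a i).det‖ₑ
  have hF : ∀ s, Measurable (F s) := by
    intro s
    refine Measurable.enorm ?_
    simp_rw [Matrix.det_apply]
    refine Finset.measurable_sum _ fun σ _ => Measurable.const_smul
      (Finset.measurable_prod _ fun i _ => ?_) _
    simp only [Matrix.of_apply]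
    by_cases h : σ i ∈ s
    · simp only [h, if_true]
      exact (measurable_pi_apply i).comp (hv.comp (measurable_pi_apply (σ i)))
    · simp only [h, if_false]
      exact measurable_const
  have H' : ∀ (L : (ι → ℝ) →ₗ[ℝ] ℝ) (j : ι), ‖L (a j)‖ₑ ≤ c * ∫⁻ y, ‖L (v y)‖ₑ ∂μ := by
    intro L j
    have hL : ∀ u, L u = (fun i => L fun j => if i = j then 1 else 0) ⬝ᵥ u := by
      intro u
      rw [LinearMap.pi_apply_eq_sum_univ L u]
      simp [dotProduct, mul_comm]
    have := H (fun i => L fun j => if i = j then 1 else 0) j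
    simpa only [← hL] using this
  have key : ∀ (s : Finset ι) (x : ι → Y),
      ‖(Matrix.of a).det‖ₑ ≤ c ^ s.card * (∫⋯∫⁻_s, F s ∂fun _ => μ) x := by
    intro s
    induction s using Finset.induction_on with
    | empty => intro x; simp [F]
    | insert i s hi ih =>
      intro x
      rw [lmarginal_insert' _ (hF _) hi, Finset.card_insert_of_notMem hi, pow_succ]
      -- The determinant is a linear functional of row `i`, so the hypothesis trades `a i` for an
      -- integral over `v yi`, at the cost of one factor `c`.
      have hstep : ∀ y, F s y ≤ c * ∫⁻ yi, F (insert i s) (Function.update y i yi) ∂μ := by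
        intro y
        let M : ι → ι → ℝ := fun j => if j ∈ s then v (y j) else a j
        let L := (Matrix.detRowAlternating (R := ℝ) (n := ι)).toMultilinearMap.toLinearMap M i
        have h1 : F s y = ‖L (a i)‖ₑ := by
          have : Function.update M i (a i) = M := by
            rw [Function.update_eq_self_iff]; simp [M, hi]
          simp only [L, MultilinearMap.toLinearMap_apply, this]
          rfl
        have h2 : ∀ yi, F (insert i s) (Function.update y i yi) = ‖L (v yi)‖ₑ := by
          intro yi
          have : (fun j => if j ∈ insert i s then v (Function.update y i yi j) else a j) =
              Function.update M i (v yi) := by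
            funext j
            by_cases hj : j = i
            · subst hj; simp
            · simp [hj, M]
          simp only [F, this]
          rfl
        simp_rw [h1, h2]
        exact H' L i
      have hmeas : Measurable fun y : ι → Y =>
          ∫⁻ yi, F (insert i s) (Function.update y i yi) ∂μ := by
        have := (hF (insert i s)).lmarginal (fun _ => μ) (s := {i})
        simpa only [lmarginal_singleton] using this
      calc _ ≤ c ^ s.card * (∫⋯∫⁻_s, F s ∂fun _ => μ) x := ih x
        _ ≤ c ^ s.card * (∫⋯∫⁻_s, (fun y => c * ∫⁻ yi, F (insert i s)
              (Function.update y i yi) ∂μ) ∂fun _ => μ) x := by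
            gcongr
            exact lmarginal_mono hstep x
        _ = _ := by
            rw [mul_assoc]
            congr 1
            simp only [lmarginal]
            rw [lintegral_const_mul]
            exact hmeas.comp measurable_updateFinset
  -- A base point is needed for the marginals. If `Y` is empty, the hypothesis forces `a = 0`.
  rcases isEmpty_or_nonempty Y with hY | ⟨⟨y0⟩⟩
  · rcases isEmpty_or_nonempty ι with hι | ⟨⟨i0⟩⟩
    · simp
    · rw [Matrix.det_eq_zero_of_row_eq_zero i0]
      · simp
      · intro j
        have := H (Pi.single j 1) i0
        simpa [Subsingleton.elim μ 0] using this
  · rw [lintegral_eq_lmarginal_univ (fun _ => y0)]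
    simpa [F] using key Finset.univ (fun _ => y0)

/-- Almost extremal choice of a matrix: a determinant functional smaller than `η` yields a matrix
with rows of `L¹` norm at most one along `v` and determinant at least `η⁻¹`. -/
theorem exists_matrix_lintegral_le_one_of_lintegral_det_lt {ι Y : Type*} [Fintype ι]
    [DecidableEq ι] [Nonempty ι]
    [MeasurableSpace Y] (μ : Measure Y) [SigmaFinite μ] {v : Y → ι → ℝ} (hv : Measurable v)
    (hfin : ∀ i, ∫⁻ y, ‖v y i‖ₑ ∂μ ≠ ⊤) {η : ℝ≥0∞}
    (hη : 2 ^ Fintype.card ι * ∫⁻ y : ι → Y, ‖(Matrix.of fun i => v (y i)).det‖ₑ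
      ∂(Measure.pi fun _ => μ) < η) :
    ∃ Q : Matrix ι ι ℝ, Q.det ≠ 0 ∧ (∀ i, ∫⁻ y, ‖Q i ⬝ᵥ v y‖ₑ ∂μ ≤ 1) ∧ 1 ≤ η * ‖Q.det‖ₑ := by
  set nrm : (ι → ℝ) → ℝ≥0∞ := fun z => ∫⁻ y, ‖z ⬝ᵥ v y‖ₑ ∂μ with hnrm
  have hη0 : η ≠ 0 := (zero_le.trans_lt hη).ne'
  have hsmul : ∀ (t : ℝ) z, nrm (t • z) = ‖t‖ₑ * nrm z := by
    intro t z
    simp only [hnrm, smul_dotProduct, smul_eq_mul, enorm_mul]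
    refine lintegral_const_mul _ (Measurable.enorm ?_)
    simp only [dotProduct]
    exact Finset.measurable_sum _ fun i _ =>
      measurable_const.mul ((measurable_pi_apply i).comp hv)
  have hlt : ∀ z, nrm z ≠ ⊤ := by
    intro z
    refine ne_top_of_le_ne_top (b := ∑ i, ‖z i‖ₑ * ∫⁻ y, ‖v y i‖ₑ ∂μ) ?_ ?_
    · exact ENNReal.sum_ne_top.2 fun i _ => ENNReal.mul_ne_top enorm_ne_top (hfin i)
    · have hm : ∀ i, Measurable fun y => ‖v y i‖ₑ := fun i =>
        ((measurable_pi_apply i).comp hv).enorm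
      rw [Finset.sum_congr rfl fun i _ => (lintegral_const_mul ‖z i‖ₑ (hm i)).symm]
      rw [← lintegral_finsetSum _ fun i _ => (hm i).const_mul _]
      refine lintegral_mono fun y => ?_
      refine (enorm_sum_le _ _).trans (le_of_eq ?_)
      simp [enorm_mul]
  set S : Set (Matrix ι ι ℝ) := {Q | ∀ i, nrm (Q i) ≤ 1} with hS
  set M : ℝ≥0∞ := ⨆ Q ∈ S, ‖Q.det‖ₑ with hM
  have hscale : ∀ z, ∃ t : ℝ, 0 < t ∧ nrm (t • z) ≤ 1 := by
    intro z
    -- The summand 1 is there because `nrm` is only a seminorm and may vanish at `z`.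
    refine ⟨1 / ((nrm z).toReal + 1), by positivity, ?_⟩
    rw [hsmul, Real.enorm_eq_ofReal (by positivity), ← ENNReal.ofReal_toReal (hlt z),
      ← ENNReal.ofReal_mul (by positivity), ← ENNReal.ofReal_one]
    refine ENNReal.ofReal_le_ofReal ?_
    rw [ENNReal.toReal_ofReal ENNReal.toReal_nonneg, one_div_mul_eq_div, div_le_one (by positivity)]
    linarith
  have hMpos : 0 < M := by
    choose t ht0 ht1 using fun i : ι => hscale (Pi.single i 1)
    refine lt_of_lt_of_le ?_ (le_iSup₂ (f := fun (Q : Matrix ι ι ℝ) (_ : Q ∈ S) => ‖Q.det‖ₑ)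
      (Matrix.diagonal t) ?_)
    · rw [enorm_pos, Matrix.det_diagonal]
      exact Finset.prod_ne_zero_iff.2 fun i _ => (ht0 i).ne'
    · intro i
      have : Matrix.diagonal t i = t i • (Pi.single i 1 : ι → ℝ) := by
        ext j
        by_cases hj : j = i
        · subst hj; simp
        · simp [hj, Matrix.diagonal_apply_ne' _ hj]
      rw [this]
      exact ht1 i
  rcases eq_or_ne M ⊤ with hMtop | hMtop
  · have : η⁻¹ < M := hMtop ▸ ENNReal.inv_lt_top.2 (pos_iff_ne_zero.2 hη0)
    obtain ⟨Q, hQS, hQ⟩ := lt_biSup_iff.1 this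
    refine ⟨Q, fun h => ?_, hQS, ?_⟩
    · simp [h] at hQ
    · rcases eq_or_ne η ⊤ with rfl | hηt
      · rw [ENNReal.top_mul (zero_le.trans_lt hQ).ne']; exact le_top
      · rw [← ENNReal.mul_inv_cancel hη0 hηt]
        gcongr
  · have : M / 2 < M := ENNReal.half_lt_self hMpos.ne' hMtop
    obtain ⟨Q, hQS, hQ⟩ := lt_biSup_iff.1 this
    have hdet : Q.det ≠ 0 := by
      intro h; simp [h] at hQ
    -- The factor 2 is the price of not asking that the supremum be attained.
    have hM2 : M ≤ 2 * ‖Q.det‖ₑ := by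
      rw [mul_comm]
      exact (ENNReal.div_le_iff (by simp) (by simp)).1 hQ.le
    refine ⟨Q, hdet, hQS, ?_⟩
    -- Columns of the adjugate: pairing `z` with `a j` replaces row `j` of `Q` by `z` in the
    -- determinant.
    let a : ι → ι → ℝ := fun j k => Q.adjugate k j
    have hrow : ∀ z j, (Q.updateRow j z).det = z ⬝ᵥ a j := by
      intro z j
      rw [← Matrix.cramer_transpose_apply, Matrix.cramer_eq_adjugate_mulVec,
        ← Matrix.adjugate_transpose]
      simp [Matrix.mulVec, dotProduct, a, mul_comm]
    have hbd : ∀ (t : ℝ) z j, nrm (t • z) ≤ 1 → ‖t‖ₑ * ‖z ⬝ᵥ a j‖ₑ ≤ 2 * ‖Q.det‖ₑ := by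
      intro t z j ht
      rw [← enorm_mul, ← smul_eq_mul, ← smul_dotProduct, ← hrow]
      refine le_trans (le_iSup₂ (f := fun (Q : Matrix ι ι ℝ) (_ : Q ∈ S) => ‖Q.det‖ₑ) _ ?_) hM2
      intro i
      by_cases hi : i = j
      · subst hi; rwa [Matrix.updateRow_self]
      · rw [Matrix.updateRow_ne hi]; exact hQS i
    have H : ∀ (z : ι → ℝ) (j : ι), ‖z ⬝ᵥ a j‖ₑ ≤ (2 * ‖Q.det‖ₑ) * ∫⁻ y, ‖z ⬝ᵥ v y‖ₑ ∂μ := by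
      intro z j
      change _ ≤ _ * nrm z
      have hc : 2 * ‖Q.det‖ₑ ≠ ⊤ := ENNReal.mul_ne_top (by simp) enorm_ne_top
      refine ENNReal.le_of_forall_pos_le_add fun ε hε _ => ?_
      set c := (2 * ‖Q.det‖ₑ).toReal with hcdef
      have hc0 : 0 < c := ENNReal.toReal_pos
        (mul_ne_zero (by simp) (enorm_ne_zero.2 hdet)) hc
      set n := (nrm z).toReal with hn
      have hn0 : 0 ≤ n := ENNReal.toReal_nonneg
      have hε' : (0 : ℝ) < ε := hε
      have hden : 0 < n + ε / c := by positivity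
      -- Normalising by `n + ε / c` instead of `n` allows `nrm z = 0`; the resulting error is
      -- exactly `ε`.
      have h1 := hbd (1 / (n + ε / c)) z j ?_
      · rw [← ENNReal.ofReal_toReal hc, ← ENNReal.ofReal_toReal (hlt z), ← hcdef, ← hn,
          ← ENNReal.ofReal_mul hc0.le, ← ENNReal.ofReal_coe_nnreal,
          ← ENNReal.ofReal_add (by positivity) hε'.le, Real.enorm_eq_ofReal_abs]
        rw [← ENNReal.ofReal_toReal hc, ← hcdef, Real.enorm_eq_ofReal (by positivity),
          Real.enorm_eq_ofReal_abs, ← ENNReal.ofReal_mul (by positivity),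
          ENNReal.ofReal_le_ofReal_iff hc0.le, one_div_mul_eq_div, div_le_iff₀ hden] at h1
        refine ENNReal.ofReal_le_ofReal (h1.trans (le_of_eq ?_))
        field_simp
      · rw [hsmul, Real.enorm_eq_ofReal (by positivity), ← ENNReal.ofReal_toReal (hlt z), ← hn,
          ← ENNReal.ofReal_mul (by positivity), ← ENNReal.ofReal_one]
        refine ENNReal.ofReal_le_ofReal ?_
        rw [one_div_mul_eq_div, div_le_one hden]
        have : 0 < ε / c := by positivity
        linarith
    have hfinal := enorm_det_le_pow_mul_lintegral_det μ hv a _ H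
    have ha : (Matrix.of a).det = Q.det ^ (Fintype.card ι - 1) := by
      rw [← Matrix.det_adjugate, ← Matrix.det_transpose]
      rfl
    rw [ha, enorm_pow, mul_pow] at hfinal
    set D := ∫⁻ y : ι → Y, ‖(Matrix.of fun i => v (y i)).det‖ₑ ∂(Measure.pi fun _ => μ)
    obtain ⟨k, hk⟩ : ∃ k, Fintype.card ι = k + 1 := ⟨_, (Nat.succ_pred Fintype.card_ne_zero).symm⟩
    set q := ‖Q.det‖ₑ
    have hq0 : q ^ k ≠ 0 := pow_ne_zero _ (enorm_ne_zero.2 hdet)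
    have hqt : q ^ k ≠ ⊤ := ENNReal.pow_ne_top enorm_ne_top
    rw [hk] at hfinal hη
    -- Since the adjugate has determinant `(det Q)^(d-1)`, cancelling `q^(d-1)` leaves `1 ≤ 2^d D
    -- q`.
    have : q ^ k * 1 ≤ q ^ k * (2 ^ (k + 1) * D * q) := by
      rw [mul_one]
      refine hfinal.trans (le_of_eq ?_)
      rw [pow_succ q]; ring
    refine ((ENNReal.mul_le_mul_iff_right hq0 hqt).1 this).trans ?_
    gcongr

/-! ### The pointwise estimate at fixed `x` -/

theorem enorm_toEuclideanLin_smul_le {d : ℕ} (Q : Matrix (Fin d) (Fin d) ℝ) (c : ℝ≥0)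
    (u : EuclideanSpace ℝ (Fin d)) :
    (c : ℝ≥0∞) * ‖Matrix.toEuclideanLin Q u‖ₑ ≤ ∑ i, ‖Q i ⬝ᵥ (fun j => (c : ℝ) * u j)‖ₑ := by
  have h1 : ‖Matrix.toEuclideanLin Q u‖ ≤ ∑ i, ‖Q i ⬝ᵥ (u : Fin d → ℝ)‖ := by
    rw [EuclideanSpace.norm_eq]
    refine Real.sqrt_le_iff.2 ⟨Finset.sum_nonneg fun _ _ => norm_nonneg _, ?_⟩
    refine le_trans (le_of_eq ?_)
      (Finset.sum_sq_le_sq_sum_of_nonneg fun i _ => norm_nonneg (Q i ⬝ᵥ (u : Fin d → ℝ)))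
    rfl
  have h2 : ‖Matrix.toEuclideanLin Q u‖ₑ ≤ ∑ i, ‖Q i ⬝ᵥ (u : Fin d → ℝ)‖ₑ := by
    simp_rw [← ofReal_norm]
    rw [← ENNReal.ofReal_sum_of_nonneg fun _ _ => norm_nonneg _]
    exact ENNReal.ofReal_le_ofReal h1
  calc (c : ℝ≥0∞) * ‖Matrix.toEuclideanLin Q u‖ₑ
      ≤ c * ∑ i, ‖Q i ⬝ᵥ (u : Fin d → ℝ)‖ₑ := by gcongr
    _ = ∑ i, ‖Q i ⬝ᵥ (fun j => (c : ℝ) * u j)‖ₑ := by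
      rw [Finset.mul_sum]
      refine Finset.sum_congr rfl fun i _ => ?_
      have : (fun j => (c : ℝ) * u j) = (c : ℝ) • (u : Fin d → ℝ) := rfl
      rw [this, dotProduct_smul, smul_eq_mul, enorm_mul]
      simp

/-- Hölder's inequality with the weight `|Q V|^s` distributed over the two factors. -/
theorem lintegral_rpow_mul_rpow_le {Y : Type*} [MeasurableSpace Y] (μ : Measure Y)
    {W a : Y → ℝ≥0∞} (hW : Measurable W) (ha : Measurable a) (ha' : ∀ y, a y ≠ ⊤)
    {G : Y → ℝ≥0} (hG : Measurable G) {s : ℝ} (hs : 0 < s)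
    (hfin : ∫⁻ y, W y / a y ^ s ∂μ ≠ ⊤) :
    ∫⁻ y, W y ^ (1 / (s + 1)) * (G y : ℝ≥0∞) ^ (s / (s + 1)) ∂μ ≤
      (∫⁻ y, W y / a y ^ s ∂μ) ^ (1 / (s + 1)) * (∫⁻ y, G y * a y ∂μ) ^ (s / (s + 1)) := by
  have hs1 : 0 < s + 1 := by linarith
  have hpq : (s + 1).HolderConjugate ((s + 1) / s) := by
    rw [Real.holderConjugate_iff]
    refine ⟨by linarith, ?_⟩
    field_simp
    ring
  have hm1 : Measurable fun y => W y / a y ^ s := hW.div (ha.pow_const s)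
  have hm2 : Measurable fun y => (G y : ℝ≥0∞) * a y := hG.coe_nnreal_ennreal.mul ha
  have := ENNReal.lintegral_mul_le_Lp_mul_Lq μ hpq
    (hm1.pow_const (1 / (s + 1))).aemeasurable (hm2.pow_const (s / (s + 1))).aemeasurable
  simp only [Pi.mul_apply, ← ENNReal.rpow_mul, one_div_div] at this
  rw [one_div_mul_cancel hs1.ne', show s / (s + 1) * ((s + 1) / s) = 1 by field_simp] at this
  simp only [ENNReal.rpow_one] at this
  refine le_trans (lintegral_mono_ae ?_) this
  -- Where `a` vanishes, finiteness of the integral forces `W = 0` almost everywhere; elsewhere the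
  -- powers of `a` cancel.
  filter_upwards [ae_lt_top hm1 hfin] with y hy
  by_cases h0 : a y = 0
  · have hW0 : W y = 0 := by
      by_contra h
      rw [h0, ENNReal.zero_rpow_of_pos hs, ENNReal.div_zero h] at hy
      exact lt_irrefl _ hy
    rw [hW0, ENNReal.zero_rpow_of_pos (by positivity), zero_mul]
    exact zero_le
  · have h1 : (a y ^ s) ≠ 0 := by simp [h0, ha' y]
    have h2 : (a y ^ s) ≠ ⊤ := ENNReal.rpow_ne_top_of_nonneg hs.le (ha' y)
    rw [ENNReal.div_rpow_of_nonneg _ _ (by positivity), ENNReal.mul_rpow_of_nonneg _ _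
      (by positivity), ← ENNReal.rpow_mul, mul_one_div]
    rw [mul_comm ((G y : ℝ≥0∞) ^ _), ← mul_assoc, ENNReal.div_mul_cancel]
    · simp [h0, ha' y]
    · exact ENNReal.rpow_ne_top_of_nonneg (by positivity) (ha' y)

/-- Combines Hölder with the nearly extremal `Q`. Integrability makes the row seminorm finite and is
removed afterwards by exhaustion. -/
theorem lintegral_le_mul_det_rpow_of_integrable {d : ℕ} (hd : 0 < d) {Y : Type*}
    [MeasurableSpace Y] (μ : Measure Y) [SigmaFinite μ] {V : Y → EuclideanSpace ℝ (Fin d)}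
    (hV : Measurable V) {W : Y → ℝ≥0∞} (hW : Measurable W) {G : Y → ℝ≥0} (hG : Measurable G)
    {s : ℝ} (hs : 0 < s) {K : ℝ≥0}
    (hK : ∀ Q : Matrix.GeneralLinearGroup (Fin d) ℝ,
      ‖(Q : Matrix (Fin d) (Fin d) ℝ).det‖ₑ ^ (s / (d : ℝ)) *
        ∫⁻ y, W y / ‖Matrix.toEuclideanLin (Q : Matrix (Fin d) (Fin d) ℝ) (V y)‖ₑ ^ s ∂μ ≤ K)
    (hfin : ∀ j, ∫⁻ y, ‖(G y : ℝ) * V y j‖ₑ ∂μ ≠ ⊤) :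
    ∫⁻ y, W y ^ (1 / (s + 1)) * (G y : ℝ≥0∞) ^ (s / (s + 1)) ∂μ ≤
      (2 * d : ℝ≥0∞) * (K : ℝ≥0∞) ^ (1 / (s + 1)) *
        (∫⁻ y : Fin d → Y, ‖(Matrix.of fun i j => (G (y i) : ℝ) * V (y i) j).det‖ₑ
          ∂(Measure.pi fun _ => μ)) ^ (s / (d * (s + 1))) := by
  have : Nonempty (Fin d) := ⟨⟨0, hd⟩⟩
  have hd' : (0 : ℝ) < d := by exact_mod_cast hd
  have hs1 : 0 < s + 1 := by linarith
  set D := ∫⁻ y : Fin d → Y, ‖(Matrix.of fun i j => (G (y i) : ℝ) * V (y i) j).det‖ₑ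
    ∂(Measure.pi fun _ => μ) with hD
  set T := ∫⁻ y, W y ^ (1 / (s + 1)) * (G y : ℝ≥0∞) ^ (s / (s + 1)) ∂μ with hT
  have hv : Measurable fun y (j : Fin d) => (G y : ℝ) * V y j := by
    refine measurable_pi_lambda _ fun j => ?_
    refine hG.coe_nnreal_real.mul ?_
    exact (EuclideanSpace.proj (𝕜 := ℝ) j).measurable.comp hV
  have hQ : ∀ Q : Matrix (Fin d) (Fin d) ℝ, Q.det ≠ 0 →
      T ≤ (K / ‖Q.det‖ₑ ^ (s / (d : ℝ))) ^ (1 / (s + 1)) *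
        (∑ i, ∫⁻ y, ‖Q i ⬝ᵥ (fun j => (G y : ℝ) * V y j)‖ₑ ∂μ) ^ (s / (s + 1)) := by
    intro Q hQ
    have hq0 : ‖Q.det‖ₑ ^ (s / (d : ℝ)) ≠ 0 := by
      simp [hQ]
    have hqt : ‖Q.det‖ₑ ^ (s / (d : ℝ)) ≠ ⊤ :=
      ENNReal.rpow_ne_top_of_nonneg (by positivity) enorm_ne_top
    have h1 : ∫⁻ y, W y / ‖Matrix.toEuclideanLin Q (V y)‖ₑ ^ s ∂μ ≤
        K / ‖Q.det‖ₑ ^ (s / (d : ℝ)) := by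
      rw [ENNReal.le_div_iff_mul_le (Or.inl hq0) (Or.inl hqt), mul_comm]
      exact hK (Matrix.GeneralLinearGroup.mkOfDetNeZero Q hQ)
    have hm : Measurable fun y => ‖Matrix.toEuclideanLin Q (V y)‖ₑ := by
      refine Measurable.enorm ?_
      exact (LinearMap.continuous_of_finiteDimensional
        (Matrix.toEuclideanLin Q)).measurable.comp hV
    refine (lintegral_rpow_mul_rpow_le μ hW hm (fun _ => enorm_ne_top) hG hs
      (ne_top_of_le_ne_top (ENNReal.div_ne_top ENNReal.coe_ne_top hq0) h1)).trans ?_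
    gcongr
    rw [← lintegral_finsetSum]
    · exact lintegral_mono fun y => enorm_toEuclideanLin_smul_le _ _ _
    · intro i _
      refine Measurable.enorm ?_
      simp only [dotProduct]
      exact Finset.measurable_sum _ fun j _ =>
        measurable_const.mul ((measurable_pi_apply j).comp hv)
  -- Treated apart because below `K ≠ 0` makes the constant `c` nonzero, and `c * ⊤` must be `⊤`.
  rcases eq_or_ne K 0 with rfl | hK0
  · refine (hQ 1 (by simp)).trans (le_of_eq ?_)
    rw [ENNReal.coe_zero, ENNReal.zero_div, ENNReal.zero_rpow_of_pos (by positivity)]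
    simp
  -- A strict majorant `η` is used because `D` may be 0, when no `Q` need satisfy the limiting
  -- bound; `η` then decreases to `2 ^ d * D`.
  have hη : ∀ η : ℝ≥0∞, 2 ^ d * D < η →
      T ≤ (d : ℝ≥0∞) * (K : ℝ≥0∞) ^ (1 / (s + 1)) * η ^ (s / (d * (s + 1))) := by
    intro η hη
    obtain ⟨Q, hQ0, hrow, hdet⟩ :=
      exists_matrix_lintegral_le_one_of_lintegral_det_lt μ hv hfin (η := η) (by
        rw [Fintype.card_fin]; exact hη)
    refine (hQ Q hQ0).trans ?_
    have hq0 : ‖Q.det‖ₑ ≠ 0 := by simpa using hQ0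
    have hA : (K : ℝ≥0∞) / ‖Q.det‖ₑ ^ (s / (d : ℝ)) ≤ K * η ^ (s / (d : ℝ)) := by
      rw [ENNReal.div_le_iff (by simp [hQ0]) (ENNReal.rpow_ne_top_of_nonneg (by positivity)
        enorm_ne_top), mul_assoc, ← ENNReal.mul_rpow_of_nonneg _ _ (by positivity)]
      calc (K : ℝ≥0∞) = K * 1 ^ (s / (d : ℝ)) := by simp
        _ ≤ _ := by gcongr
    have hB : ∑ i, ∫⁻ y, ‖Q i ⬝ᵥ (fun j => (G y : ℝ) * V y j)‖ₑ ∂μ ≤ d := by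
      refine (Finset.sum_le_sum fun i _ => hrow i).trans (le_of_eq ?_)
      simp
    have hd1 : (d : ℝ≥0∞) ^ (s / (s + 1)) ≤ d := by
      conv_rhs => rw [← ENNReal.rpow_one (d : ℝ≥0∞)]
      refine ENNReal.rpow_le_rpow_of_exponent_le (by exact_mod_cast hd) ?_
      rw [div_le_one hs1]; linarith
    calc _ ≤ (K * η ^ (s / (d : ℝ))) ^ (1 / (s + 1)) * (d : ℝ≥0∞) ^ (s / (s + 1)) := by gcongr
      _ ≤ (K * η ^ (s / (d : ℝ))) ^ (1 / (s + 1)) * d := by gcongr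
      _ = _ := by
        rw [ENNReal.mul_rpow_of_nonneg _ _ (by positivity), ← ENNReal.rpow_mul,
          div_mul_div_comm, mul_one]
        ring
  set c : ℝ≥0∞ := (d : ℝ≥0∞) * (K : ℝ≥0∞) ^ (1 / (s + 1)) with hc
  have hct : c ≠ ⊤ := ENNReal.mul_ne_top (by simp)
    (ENNReal.rpow_ne_top_of_nonneg (by positivity) ENNReal.coe_ne_top)
  have hc0 : c ≠ 0 := by
    refine mul_ne_zero (by exact_mod_cast hd.ne') ?_
    simp [hK0]
  have hlim : T ≤ c * (2 ^ d * D) ^ (s / (d * (s + 1))) := by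
    rcases eq_or_ne (2 ^ d * D) ⊤ with htop | htop
    · rw [htop, ENNReal.top_rpow_of_pos (by positivity), ENNReal.mul_top hc0]
      exact le_top
    · have hcont : Continuous fun η : ℝ≥0∞ => c * η ^ (s / (d * (s + 1))) :=
        (ENNReal.continuous_const_mul hct).comp ENNReal.continuous_rpow_const
      have hne : (nhdsWithin (2 ^ d * D) (Set.Ioi (2 ^ d * D))).NeBot :=
        nhdsGT_neBot_of_exists_gt ⟨⊤, lt_top_iff_ne_top.2 htop⟩
      refine ge_of_tendsto (hcont.continuousWithinAt (s := Set.Ioi (2 ^ d * D))) ?_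
      filter_upwards [self_mem_nhdsWithin] with η h
      exact hη η h
  refine hlim.trans ?_
  rw [ENNReal.mul_rpow_of_nonneg _ _ (by positivity), hc]
  have h2 : ((2 : ℝ≥0∞) ^ d) ^ (s / (d * (s + 1))) ≤ 2 := by
    rw [← ENNReal.rpow_natCast, ← ENNReal.rpow_mul]
    conv_rhs => rw [← ENNReal.rpow_one (2 : ℝ≥0∞)]
    refine ENNReal.rpow_le_rpow_of_exponent_le (by norm_num) ?_
    rw [show (d : ℝ) * (s / (d * (s + 1))) = s / (s + 1) by field_simp, div_le_one hs1]
    linarith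
  calc _ ≤ (d : ℝ≥0∞) * (K : ℝ≥0∞) ^ (1 / (s + 1)) * (2 * D ^ (s / (d * (s + 1)))) := by gcongr
    _ = _ := by ring

/-- The pointwise estimate: the weighted average is controlled by the determinant functional. -/
theorem lintegral_le_mul_det_rpow {d : ℕ} (hd : 0 < d) {Y : Type*}
    [MeasurableSpace Y] (μ : Measure Y) [SigmaFinite μ] {V : Y → EuclideanSpace ℝ (Fin d)}
    (hV : Measurable V) {W : Y → ℝ≥0∞} (hW : Measurable W) {G : Y → ℝ≥0} (hG : Measurable G)
    {s : ℝ} (hs : 0 < s) {K : ℝ≥0}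
    (hK : ∀ Q : Matrix.GeneralLinearGroup (Fin d) ℝ,
      ‖(Q : Matrix (Fin d) (Fin d) ℝ).det‖ₑ ^ (s / (d : ℝ)) *
        ∫⁻ y, W y / ‖Matrix.toEuclideanLin (Q : Matrix (Fin d) (Fin d) ℝ) (V y)‖ₑ ^ s ∂μ ≤ K) :
    ∫⁻ y, W y ^ (1 / (s + 1)) * (G y : ℝ≥0∞) ^ (s / (s + 1)) ∂μ ≤
      (2 * d : ℝ≥0∞) * (K : ℝ≥0∞) ^ (1 / (s + 1)) *
        (∫⁻ y : Fin d → Y, ‖(Matrix.of fun i j => (G (y i) : ℝ) * V (y i) j).det‖ₑ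
          ∂(Measure.pi fun _ => μ)) ^ (s / (d * (s + 1))) := by
  have hm : ∀ j, Measurable fun y => (G y : ℝ) * V y j := fun j =>
    hG.coe_nnreal_real.mul ((EuclideanSpace.proj (𝕜 := ℝ) j).measurable.comp hV)
  let B : ℕ → Set Y := fun n => {y | ∀ j, ‖(G y : ℝ) * V y j‖ₑ ≤ n}
  have hBm : ∀ n, MeasurableSet (B n) := by
    intro n
    simp only [B, Set.ofPred_forall]
    exact MeasurableSet.iInter fun j => measurableSet_le (hm j).enorm measurable_const
  -- Exhaustion by sets of finite measure on which `G V` is bounded. Restricting `μ` only decreases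
  -- the integrals in `hK` and in `D`.
  let A : ℕ → Set Y := fun n => spanningSets μ n ∩ B n
  have hAm : ∀ n, MeasurableSet (A n) := fun n => (measurableSet_spanningSets μ n).inter (hBm n)
  have hBmono : Monotone B := fun n m hnm y hy j => (hy j).trans (by exact_mod_cast hnm)
  have hAmono : Monotone A := fun n m hnm =>
    Set.inter_subset_inter (monotone_spanningSets μ hnm) (hBmono hnm)
  have hAU : ⋃ n, A n = Set.univ := by
    rw [Set.iUnion_inter_of_monotone (monotone_spanningSets μ) hBmono, iUnion_spanningSets,
      Set.univ_inter, Set.eq_univ_iff_forall]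
    intro y
    obtain ⟨n, hn⟩ := ENNReal.exists_nat_gt
      (ENNReal.sum_ne_top.2 fun j (_ : j ∈ Finset.univ) =>
        (enorm_ne_top : ‖(G y : ℝ) * V y j‖ₑ ≠ ⊤))
    exact Set.mem_iUnion.2 ⟨n, fun j =>
      (Finset.single_le_sum (f := fun j => ‖(G y : ℝ) * V y j‖ₑ) (fun _ _ => zero_le)
        (Finset.mem_univ j)).trans hn.le⟩
  rw [← setLIntegral_univ, ← hAU, setLIntegral_iUnion_of_directed _ hAmono.directed_le]
  refine iSup_le fun n => ?_
  have hfin : ∀ j, ∫⁻ y in A n, ‖(G y : ℝ) * V y j‖ₑ ∂μ ≠ ⊤ := by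
    intro j
    refine ne_top_of_le_ne_top (b := ∫⁻ _ in A n, (n : ℝ≥0∞) ∂μ) ?_
      (setLIntegral_mono measurable_const fun y hy => hy.2 j)
    rw [setLIntegral_const]
    exact ENNReal.mul_ne_top (by simp) ((measure_mono Set.inter_subset_left).trans_lt
      (measure_spanningSets_lt_top μ n)).ne
  refine (lintegral_le_mul_det_rpow_of_integrable hd (μ.restrict (A n)) hV hW hG hs
    (fun Q => le_trans ?_ (hK Q)) hfin).trans ?_
  · gcongr
    exact Measure.restrict_le_self
  · have h0 : 0 ≤ s / (d * (s + 1)) := by positivity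
    rw [← Measure.restrict_pi_pi]
    gcongr
    exact Measure.restrict_le_self

/-! ### Gradients of slices and the change of variables -/

section Slices

variable {dl dr : ℕ} {U E : Set (EuclideanSpace ℝ (Fin dl) × EuclideanSpace ℝ (Fin dr))}
  {ρ : EuclideanSpace ℝ (Fin dl) × EuclideanSpace ℝ (Fin dr) → ℝ}

theorem hasFDerivAt_slice (hU : IsOpen U) (hρ : ContDiffOn ℝ ∞ ρ U)
    {x : EuclideanSpace ℝ (Fin dl)} {y : EuclideanSpace ℝ (Fin dr)} (h : (x, y) ∈ U) :
    HasFDerivAt (fun x' => ρ (x', y)) ((fderiv ℝ ρ (x, y)).comp (ContinuousLinearMap.inl ℝ _ _))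
      x := by
  have h1 : HasFDerivAt ρ (fderiv ℝ ρ (x, y)) (x, y) :=
    ((hρ.contDiffAt (hU.mem_nhds h)).differentiableAt (by simp)).hasFDerivAt
  exact h1.comp x (hasFDerivAt_prodMk_left x y)

theorem measurable_indicator_gradX (hU : IsOpen U) (hρ : ContDiffOn ℝ ∞ ρ U) (hEU : E ⊆ U)
    (hE : MeasurableSet E) : Measurable (E.indicator fun z => gradX ρ z.1 z.2) := by
  classical
  have h1 : ContinuousOn (fun z => gradX ρ z.1 z.2) U := by
    have h2 : ContinuousOn (fun z => (InnerProductSpace.toDual ℝ _).symm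
        ((fderiv ℝ ρ z).comp (ContinuousLinearMap.inl ℝ (EuclideanSpace ℝ (Fin dl))
          (EuclideanSpace ℝ (Fin dr))))) U := by
      refine (LinearIsometryEquiv.continuous _).comp_continuousOn ?_
      exact (hρ.continuousOn_fderiv_of_isOpen hU (by simp)).clm_comp continuousOn_const
    refine h2.congr fun z hz => ?_
    simp only [gradX, gradient]
    rw [(hasFDerivAt_slice hU hρ (x := z.1) (y := z.2) hz).fderiv]
  rw [← Set.piecewise_eq_indicator]
  exact (h1.mono hEU).measurable_piecewise continuousOn_const hE

theorem hasFDerivAt_gradX (hU : IsOpen U) (hρ : ContDiffOn ℝ ∞ ρ U)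
    {x : EuclideanSpace ℝ (Fin dl)} {y : EuclideanSpace ℝ (Fin dr)} (h : (x, y) ∈ U) :
    HasFDerivAt (fun x' => ρ (x', y)) (InnerProductSpace.toDual ℝ _ (gradX ρ x y)) x :=
  (hasFDerivAt_slice hU hρ h).differentiableAt.hasGradientAt.hasFDerivAt

/-- For fixed `y₁, …, y_d`, the change of variables `x ↦ (ρ(x, y₁), …, ρ(x, y_d))`. -/
theorem lintegral_det_gradX_le (hU : IsOpen U) (hρ : ContDiffOn ℝ ∞ ρ U) (hEU : E ⊆ U)
    (hE : MeasurableSet E) {N : ℕ} (hN : TransverseBound U ρ E N)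
    (y : Fin dl → EuclideanSpace ℝ (Fin dr)) :
    ∫⁻ x, ‖(Matrix.of fun i j => E.indicator (fun z => gradX ρ z.1 z.2) (x, y i) j).det‖ₑ ≤
      N * ∏ i, volume ((fun x => ρ (x, y i)) '' {x | (x, y i) ∈ E}) := by
  set V := E.indicator fun z => gradX ρ z.1 z.2 with hV
  have hVm : Measurable V := measurable_indicator_gradX hU hρ hEU hE
  let M : EuclideanSpace ℝ (Fin dl) → Matrix (Fin dl) (Fin dl) ℝ :=
    fun x => Matrix.of fun i j => V (x, y i) j
  have hMm : Measurable fun x => (M x).det := by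
    simp_rw [Matrix.det_apply]
    refine Finset.measurable_sum _ fun σ _ => Measurable.const_smul
      (Finset.measurable_prod _ fun i _ => ?_) _
    exact (EuclideanSpace.proj (𝕜 := ℝ) i).measurable.comp
      (hVm.comp (measurable_id.prodMk measurable_const))
  set S : Set (EuclideanSpace ℝ (Fin dl)) := {x | (M x).det ≠ 0} with hS
  have hSm : MeasurableSet S := measurableSet_eq_fun hMm measurable_const |>.compl
  -- If some `(x, y i)` is outside `E`, row `i` is zero.
  have hSE : ∀ x ∈ S, ∀ i, (x, y i) ∈ E := by
    intro x hx i
    by_contra h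
    refine hx (Matrix.det_eq_zero_of_row_eq_zero i fun j => ?_)
    simp [M, hV, Set.indicator_of_notMem h]
  have hMS : ∀ x ∈ S, M x = Matrix.of fun i j => gradX ρ x (y i) j := by
    intro x hx
    ext i j
    simp [M, hV, Set.indicator_of_mem (hSE x hx i)]
  let φ : EuclideanSpace ℝ (Fin dl) → EuclideanSpace ℝ (Fin dl) :=
    fun x => WithLp.toLp 2 fun i => ρ (x, y i)
  let φ' : EuclideanSpace ℝ (Fin dl) → EuclideanSpace ℝ (Fin dl) →L[ℝ] EuclideanSpace ℝ (Fin dl) :=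
    fun x => LinearMap.toContinuousLinearMap (Matrix.toEuclideanLin (M x))
  have hdet : ∀ x, (φ' x).det = (M x).det := by
    intro x
    simp only [φ', ContinuousLinearMap.det, LinearMap.coe_toContinuousLinearMap]
    exact LinearMap.det_toLin (PiLp.basisFun 2 ℝ (Fin dl)) (M x)
  have hderiv : ∀ x ∈ S, HasFDerivWithinAt φ (φ' x) S x := by
    intro x hx
    rw [hasFDerivWithinAt_euclidean]
    intro i
    have h := hasFDerivAt_gradX hU hρ (hEU (hSE x hx i))
    refine HasFDerivAt.hasFDerivWithinAt ?_
    refine h.congr_fderiv (ContinuousLinearMap.ext fun u => ?_)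
    simp only [φ', ContinuousLinearMap.comp_apply, InnerProductSpace.toDual_apply_apply,
      LinearMap.coe_toContinuousLinearMap', PiLp.proj_apply, Matrix.toLpLin_apply, hMS x hx]
    simp [Matrix.mulVec, dotProduct, PiLp.inner_apply, mul_comm]
  have hcard : ∀ c ∈ φ '' S, (S ∩ φ ⁻¹' {c}).encard ≤ (N : ℕ∞) := by
    rintro c ⟨x0, hx0, rfl⟩
    refine (Set.encard_le_encard ?_).trans
      (hN y (fun i => ρ (x0, y i)) fun i => ⟨_, hSE x0 hx0 i, rfl⟩)
    rintro x ⟨hx, hxc⟩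
    have hd : (Matrix.of fun i j => gradX ρ x (y i) j).det ≠ 0 := by
      rw [← hMS x hx]; exact hx
    refine ⟨Set.mem_iInter.2 fun i => ⟨hEU (hSE x hx i), ?_, fun h0 => hd ?_⟩, abs_ne_zero.2 hd⟩
    · exact congrArg (fun u : EuclideanSpace ℝ (Fin dl) => u i) hxc
    · exact Matrix.det_eq_zero_of_row_eq_zero i fun j => by simp [h0]
  have hsub : φ '' S ⊆ (WithLp.ofLp : EuclideanSpace ℝ (Fin dl) → Fin dl → ℝ) ⁻¹'
      Set.univ.pi fun i => (fun x => ρ (x, y i)) '' {x | (x, y i) ∈ E} := by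
    rintro _ ⟨x, hx, rfl⟩ i _
    exact ⟨x, hSE x hx i, rfl⟩
  have hvol : volume (φ '' S) ≤ ∏ i, volume ((fun x => ρ (x, y i)) '' {x | (x, y i) ∈ E}) := by
    refine (measure_mono hsub).trans (le_of_eq ?_)
    -- The product formula holds for arbitrary sets, so measurability of the images `ρ(E^y)` is not
    -- needed.
    rw [← volume_pi_pi]
    exact (PiLp.volume_preserving_ofLp (Fin dl)).measure_preimage_emb
      (MeasurableEquiv.toLp 2 (Fin dl → ℝ)).symm.measurableEmbedding _
  calc ∫⁻ x, ‖(M x).det‖ₑ = ∫⁻ x in S, ENNReal.ofReal |(φ' x).det| := by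
        rw [← lintegral_indicator hSm]
        refine lintegral_congr fun x => ?_
        by_cases hx : x ∈ S
        · rw [Set.indicator_of_mem hx, hdet, Real.enorm_eq_ofReal_abs]
        · rw [Set.indicator_of_notMem hx]
          simpa [S] using hx
    _ ≤ N * volume (φ '' S) :=
        lintegral_abs_det_fderiv_le_of_encard_fiber_le volume hSm hderiv
          (fun x hx => by rw [hdet]; exact hx) hcard
    _ ≤ _ := by gcongr

theorem measurable_det_weighted {V : EuclideanSpace ℝ (Fin dl) × EuclideanSpace ℝ (Fin dr) →
    EuclideanSpace ℝ (Fin dl)} (hV : Measurable V) {G : EuclideanSpace ℝ (Fin dr) → ℝ≥0}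
    (hG : Measurable G) :
    Measurable fun z : EuclideanSpace ℝ (Fin dl) × (Fin dl → EuclideanSpace ℝ (Fin dr)) =>
      ‖(Matrix.of fun i j => (G (z.2 i) : ℝ) * V (z.1, z.2 i) j).det‖ₑ := by
  refine Measurable.enorm ?_
  simp_rw [Matrix.det_apply]
  refine Finset.measurable_sum _ fun σ _ => Measurable.const_smul
    (Finset.measurable_prod _ fun i _ => ?_) _
  have hy : Measurable fun z : EuclideanSpace ℝ (Fin dl) × (Fin dl → EuclideanSpace ℝ (Fin dr)) =>
      z.2 (σ i) := (measurable_pi_apply _).comp measurable_snd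
  exact (hG.comp hy).coe_nnreal_real.mul ((EuclideanSpace.proj (𝕜 := ℝ) i).measurable.comp
    (hV.comp (measurable_fst.prodMk hy)))

/-- Tonelli puts the `x` integral inside, the weights factor out of the rows, and the essential
supremum bounds every width for almost every tuple. -/
theorem lintegral_lintegral_det_gradX_le (hU : IsOpen U) (hρ : ContDiffOn ℝ ∞ ρ U) (hEU : E ⊆ U)
    (hE : MeasurableSet E) {N : ℕ} (hN : TransverseBound U ρ E N)
    {G : EuclideanSpace ℝ (Fin dr) → ℝ≥0} (hG : Measurable G) :
    ∫⁻ x, ∫⁻ y : Fin dl → EuclideanSpace ℝ (Fin dr), ‖(Matrix.of fun i j =>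
        (G (y i) : ℝ) * E.indicator (fun z => gradX ρ z.1 z.2) (x, y i) j).det‖ₑ
        ∂(Measure.pi fun _ => volume) ≤
      N * leftWidth ρ E ^ dl * (∫⁻ y, G y) ^ dl := by
  have hVm := measurable_indicator_gradX hU hρ hEU hE
  have hwidth : ∀ᵐ y : EuclideanSpace ℝ (Fin dr),
      volume ((fun x => ρ (x, y)) '' {x | (x, y) ∈ E}) ≤ leftWidth ρ E :=
    ENNReal.ae_le_essSup fun y => volume ((fun x => ρ (x, y)) '' {x | (x, y) ∈ E})
  have hae : ∀ᵐ y : Fin dl → EuclideanSpace ℝ (Fin dr) ∂(Measure.pi fun _ => volume),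
      ∀ i, volume ((fun x => ρ (x, y i)) '' {x | (x, y i) ∈ E}) ≤ leftWidth ρ E :=
    ae_all_iff.2 fun i => (Measure.tendsto_eval_ae_ae (i := i)
      (μ := fun _ : Fin dl => (volume : Measure (EuclideanSpace ℝ (Fin dr))))).eventually hwidth
  have hGp : Measurable fun y : Fin dl → EuclideanSpace ℝ (Fin dr) => ∏ i, (G (y i) : ℝ≥0∞) :=
    Finset.measurable_prod _ fun i _ => (hG.comp (measurable_pi_apply i)).coe_nnreal_ennreal
  let F : EuclideanSpace ℝ (Fin dl) → (Fin dl → EuclideanSpace ℝ (Fin dr)) → ℝ≥0∞ := fun x y =>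
    ‖(Matrix.of fun i j =>
      (G (y i) : ℝ) * E.indicator (fun z => gradX ρ z.1 z.2) (x, y i) j).det‖ₑ
  have hF : Measurable (Function.uncurry F) := measurable_det_weighted hVm hG
  calc ∫⁻ x, ∫⁻ y, F x y ∂(Measure.pi fun _ => volume)
      = ∫⁻ y, (∫⁻ x, F x y) ∂(Measure.pi fun _ => volume) :=
        lintegral_lintegral_swap hF.aemeasurable
    _ ≤ ∫⁻ y : Fin dl → EuclideanSpace ℝ (Fin dr), N * leftWidth ρ E ^ dl *
        ∏ i, (G (y i) : ℝ≥0∞) ∂(Measure.pi fun _ => volume) := by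
        refine lintegral_mono_ae ?_
        filter_upwards [hae] with y hy
        have h1 : ∀ x, F x y =
            (∏ i, (G (y i) : ℝ≥0∞)) * ‖(Matrix.of fun i j =>
              E.indicator (fun z => gradX ρ z.1 z.2) (x, y i) j).det‖ₑ := by
          intro x
          have := Matrix.det_mul_column (fun i => (G (y i) : ℝ)) (Matrix.of fun i j =>
            E.indicator (fun z => gradX ρ z.1 z.2) (x, y i) j)
          simp only [Matrix.of_apply] at this
          simp only [F]
          rw [this, enorm_mul]
          congr 1
          rw [Real.enorm_eq_ofReal (by positivity), ENNReal.ofReal_prod_of_nonneg (by simp)]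
          simp
        simp_rw [h1]
        rw [lintegral_const_mul' _ _ (ENNReal.prod_ne_top fun i _ => ENNReal.coe_ne_top), mul_comm]
        gcongr
        refine (lintegral_det_gradX_le hU hρ hEU hE hN y).trans ?_
        gcongr
        refine (Finset.prod_le_prod' fun i _ => hy i).trans (le_of_eq ?_)
        simp
    _ = _ := by
        rw [lintegral_const_mul _ hGp,
          lintegral_pi_prod_eq_prod_lintegral volume hG.coe_nnreal_ennreal, Fintype.card_fin]

end Slices

/-! ### Assembly -/

/-- The hypothesis on `geometricSup`, for a measurable representative of the weight and extended
by zero to all `y`. -/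
theorem ae_det_rpow_mul_lintegral_le {dl dr : ℕ}
    {U E : Set (EuclideanSpace ℝ (Fin dl) × EuclideanSpace ℝ (Fin dr))}
    {ρ w w' : EuclideanSpace ℝ (Fin dl) × EuclideanSpace ℝ (Fin dr) → ℝ} (hU : IsOpen U)
    (hEU : E ⊆ U) (hw : w =ᵐ[volume.restrict U] w') {s : ℝ} :
    ∀ᵐ x : EuclideanSpace ℝ (Fin dl), ∀ Q : Matrix.GeneralLinearGroup (Fin dl) ℝ,
      ‖(Q : Matrix (Fin dl) (Fin dl) ℝ).det‖ₑ ^ (s / (dl : ℝ)) *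
        ∫⁻ y, E.indicator (fun z => ‖w' z‖ₑ) (x, y) /
          ‖Matrix.toEuclideanLin (Q : Matrix (Fin dl) (Fin dl) ℝ)
            (E.indicator (fun z => gradX ρ z.1 z.2) (x, y))‖ₑ ^ s ≤ geometricSup U ρ E w s := by
  have h1 : ∀ᵐ z : EuclideanSpace ℝ (Fin dl) × EuclideanSpace ℝ (Fin dr), z ∈ U → w z = w' z :=
    (ae_restrict_iff' hU.measurableSet).1 hw
  rw [Measure.volume_eq_prod] at h1
  -- The exceptional null set of `x` comes only from `w ≠ w'`, so it does not depend on `Q`.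
  filter_upwards [Measure.ae_ae_of_ae_prod h1] with x hx Q
  refine le_trans ?_ (le_iSup₂ (f := fun (x : EuclideanSpace ℝ (Fin dl))
    (Q : Matrix.GeneralLinearGroup (Fin dl) ℝ) =>
    ‖(Q : Matrix (Fin dl) (Fin dl) ℝ).det‖ₑ ^ (s / (dl : ℝ)) *
      ∫⁻ y in {y | (x, y) ∈ U},
        (‖w (x, y)‖ₑ * E.indicator (fun _ => (1 : ℝ≥0∞)) (x, y)) /
          ‖Matrix.toEuclideanLin (Q : Matrix (Fin dl) (Fin dl) ℝ) (gradX ρ x y)‖ₑ ^ s) x Q)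
  refine mul_le_mul_right ?_ _
  have hUx : MeasurableSet {y : EuclideanSpace ℝ (Fin dr) | (x, y) ∈ U} :=
    (hU.preimage (by fun_prop : Continuous fun y : EuclideanSpace ℝ (Fin dr) => (x, y))).measurableSet
  rw [← lintegral_indicator hUx]
  refine lintegral_mono_ae ?_
  filter_upwards [hx] with y hy
  by_cases hE : (x, y) ∈ E
  · rw [Set.indicator_of_mem (show y ∈ {y | (x, y) ∈ U} from hEU hE)]
    simp only [Set.indicator_of_mem hE, hy (hEU hE), mul_one]
    exact le_rfl
  -- Off `E` the truncated gradient is zero too, and the convention `0 / 0 = 0` applies.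
  · rw [Set.indicator_of_notMem hE, ENNReal.zero_div]
    exact zero_le

theorem lintegral_weight_mul_le {dl : ℕ} (hdl : 0 < dl) {dr : ℕ}
    {U E : Set (EuclideanSpace ℝ (Fin dl) × EuclideanSpace ℝ (Fin dr))}
    {ρ w w' : EuclideanSpace ℝ (Fin dl) × EuclideanSpace ℝ (Fin dr) → ℝ} {s p' : ℝ} {K : ℝ≥0}
    {N : ℕ} (hU : IsOpen U) (hρ : ContDiffOn ℝ ∞ ρ U) (hEU : E ⊆ U) (hE : MeasurableSet E)
    (hw' : Measurable w') (hw : w =ᵐ[volume.restrict U] w') (hs : 0 < s)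
    (hp' : 1 / p' = 1 - 1 / (dl : ℝ) * (s / (s + 1)))
    (hK : geometricSup U ρ E w s ≤ (K : ℝ≥0∞)) (hN : TransverseBound U ρ E N)
    {f : EuclideanSpace ℝ (Fin dl) → ℝ≥0∞} (hf : Measurable f)
    {G : EuclideanSpace ℝ (Fin dr) → ℝ≥0} (hG : Measurable G) :
    ∫⁻ x, f x * ∫⁻ y, E.indicator (fun z => ‖w' z‖ₑ) (x, y) ^ (1 / (s + 1)) *
        (G y : ℝ≥0∞) ^ (s / (s + 1)) ≤
      (2 * dl : ℝ≥0∞) * (N : ℝ≥0∞) ^ (s / ((dl : ℝ) * (s + 1))) *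
        (K : ℝ≥0∞) ^ (1 / (s + 1)) * leftWidth ρ E ^ (s / (s + 1)) *
        (∫⁻ x, f x ^ p') ^ (1 / p') * (∫⁻ y, G y) ^ (s / (s + 1)) := by
  have hs1 : 0 < s + 1 := by linarith
  have hd' : (0 : ℝ) < dl := by exact_mod_cast hdl
  have hd1 : (1 : ℝ) ≤ dl := by exact_mod_cast hdl
  -- Chosen so that `1/p` is the power of `D` in the pointwise estimate; its conjugate exponent is
  -- the given `p'`.
  set p : ℝ := dl * (s + 1) / s with hp
  have hp0 : 0 < p := by positivity
  have hpinv : 1 / p = s / (dl * (s + 1)) := by rw [hp, one_div_div]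
  have hpp : p'.HolderConjugate p := by
    refine Real.HolderConjugate.symm (Real.holderConjugate_iff.2 ⟨?_, ?_⟩)
    · rw [hp, lt_div_iff₀ hs]; nlinarith
    · rw [← one_div p', hp', ← one_div p, hpinv]
      field_simp
      ring
  set V := E.indicator fun z => gradX ρ z.1 z.2 with hV
  have hVm : Measurable V := measurable_indicator_gradX hU hρ hEU hE
  let D : EuclideanSpace ℝ (Fin dl) → ℝ≥0∞ := fun x =>
    ∫⁻ y : Fin dl → EuclideanSpace ℝ (Fin dr), ‖(Matrix.of fun i j =>
        (G (y i) : ℝ) * V (x, y i) j).det‖ₑ ∂(Measure.pi fun _ => volume)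
  have hD : Measurable D := (measurable_det_weighted hVm hG).lintegral_prod_right'
  have hWm : Measurable (E.indicator fun z => ‖w' z‖ₑ) := hw'.enorm.indicator hE
  have hpt : ∀ᵐ x, ∫⁻ y, E.indicator (fun z => ‖w' z‖ₑ) (x, y) ^ (1 / (s + 1)) *
      (G y : ℝ≥0∞) ^ (s / (s + 1)) ≤
        (2 * dl : ℝ≥0∞) * (K : ℝ≥0∞) ^ (1 / (s + 1)) * D x ^ (1 / p) := by
    filter_upwards [ae_det_rpow_mul_lintegral_le (ρ := ρ) (s := s) hU hEU hw] with x hx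
    rw [hpinv]
    exact lintegral_le_mul_det_rpow hdl volume (V := fun y => V (x, y))
      (hVm.comp measurable_prodMk_left) (hWm.comp measurable_prodMk_left) hG hs
      fun Q => (hx Q).trans hK
  have hc : (2 * dl : ℝ≥0∞) * (K : ℝ≥0∞) ^ (1 / (s + 1)) ≠ ⊤ :=
    ENNReal.mul_ne_top (ENNReal.mul_ne_top (by simp) (by simp))
      (ENNReal.rpow_ne_top_of_nonneg (by positivity) ENNReal.coe_ne_top)
  have hDint : (∫⁻ x, D x) ^ (1 / p) ≤ (N : ℝ≥0∞) ^ (s / ((dl : ℝ) * (s + 1))) *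
      leftWidth ρ E ^ (s / (s + 1)) * (∫⁻ y, G y) ^ (s / (s + 1)) := by
    have hexp : (dl : ℝ) * (1 / p) = s / (s + 1) := by rw [hpinv]; field_simp
    calc (∫⁻ x, D x) ^ (1 / p)
        ≤ (N * leftWidth ρ E ^ dl * (∫⁻ y, (G y : ℝ≥0∞)) ^ dl) ^ (1 / p) := by
          gcongr
          exact lintegral_lintegral_det_gradX_le hU hρ hEU hE hN hG
      _ = _ := by
          rw [ENNReal.mul_rpow_of_nonneg _ _ (by positivity),
            ENNReal.mul_rpow_of_nonneg _ _ (by positivity), ← ENNReal.rpow_natCast,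
            ← ENNReal.rpow_natCast, ← ENNReal.rpow_mul, ← ENNReal.rpow_mul, hexp, hpinv]
  calc _ ≤ ∫⁻ x, ((2 * dl : ℝ≥0∞) * (K : ℝ≥0∞) ^ (1 / (s + 1))) * (f x * D x ^ (1 / p)) := by
        refine lintegral_mono_ae ?_
        filter_upwards [hpt] with x hx
        rw [mul_left_comm]
        gcongr
    _ = ((2 * dl : ℝ≥0∞) * (K : ℝ≥0∞) ^ (1 / (s + 1))) * ∫⁻ x, f x * D x ^ (1 / p) :=
        lintegral_const_mul' _ _ hc
    _ ≤ ((2 * dl : ℝ≥0∞) * (K : ℝ≥0∞) ^ (1 / (s + 1))) *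
        ((∫⁻ x, f x ^ p') ^ (1 / p') * (∫⁻ x, D x) ^ (1 / p)) := by
        gcongr
        have := ENNReal.lintegral_mul_le_Lp_mul_Lq volume hpp hf.aemeasurable
          (hD.pow_const (1 / p)).aemeasurable
        simpa only [Pi.mul_apply, ← ENNReal.rpow_mul, one_div_mul_cancel hp0.ne',
          ENNReal.rpow_one] using this
    _ ≤ ((2 * dl : ℝ≥0∞) * (K : ℝ≥0∞) ^ (1 / (s + 1))) *
        ((∫⁻ x, f x ^ p') ^ (1 / p') * ((N : ℝ≥0∞) ^ (s / ((dl : ℝ) * (s + 1))) *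
          leftWidth ρ E ^ (s / (s + 1)) * (∫⁻ y, G y) ^ (s / (s + 1)))) := by gcongr
    _ = _ := by ring

theorem mainTheorem3 (dl : ℕ) (hdl : 0 < dl) :
    ∃ C : ℝ≥0, ∀ (dr : ℕ)
      (U : Set (EuclideanSpace ℝ (Fin dl) × EuclideanSpace ℝ (Fin dr)))
      (ρ : EuclideanSpace ℝ (Fin dl) × EuclideanSpace ℝ (Fin dr) → ℝ)
      (E : Set (EuclideanSpace ℝ (Fin dl) × EuclideanSpace ℝ (Fin dr)))
      (w : EuclideanSpace ℝ (Fin dl) × EuclideanSpace ℝ (Fin dr) → ℝ)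
      (s p' : ℝ) (K : ℝ≥0) (N : ℕ),
      IsOpen U →
      ContDiffOn ℝ ∞ ρ U →
      (∃ F, IsClosed F ∧ E = U ∩ F) →
      AEMeasurable w (volume.restrict U) →
      0 < s →
      1 / p' = 1 - 1 / (dl : ℝ) * (s / (s + 1)) →
      geometricSup U ρ E w s ≤ (K : ℝ≥0∞) →
      TransverseBound U ρ E N →
      ∀ (f : EuclideanSpace ℝ (Fin dl) → ℂ) (g : EuclideanSpace ℝ (Fin dr) → ℂ),
        AEStronglyMeasurable f volume →
        AEStronglyMeasurable g volume →
        ∫⁻ z in E, ‖w z‖ₑ ^ (1 / (s + 1)) * ‖f z.1 * g z.2‖ₑ ≤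
          ((C : ℝ≥0∞) * (N : ℝ≥0∞) ^ (s / ((dl : ℝ) * (s + 1)))) *
            (K : ℝ≥0∞) ^ (1 / (s + 1)) * leftWidth ρ E ^ (s / (s + 1)) *
            eLpNorm f (ENNReal.ofReal p') volume *
            eLpNorm g (ENNReal.ofReal ((s + 1) / s)) volume := by
  -- The 2 comes from near extremality, the `dl` from summing the rows of `Q`.
  refine ⟨2 * dl, ?_⟩
  rintro dr U ρ E w s p' K N hU hρ ⟨F, hF, rfl⟩ hw hs hp' hK hN f g hf hg
  have hEm : MeasurableSet (U ∩ F) := hU.measurableSet.inter hF.measurableSet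
  have hs1 : 0 < s + 1 := by linarith
  have hd1 : (1 : ℝ) ≤ dl := by exact_mod_cast hdl
  have hd0 : (0 : ℝ) < dl := by linarith
  have hp0 : 0 < p' := by
    have h1 : 1 / (dl : ℝ) * (s / (s + 1)) < 1 := by
      rw [div_mul_div_comm, one_mul, div_lt_one (by positivity)]
      nlinarith
    rw [← one_div_pos, hp']
    linarith
  have hq0 : 0 < (s + 1) / s := by positivity
  let f' := hf.mk f
  let g' := hg.mk g
  obtain ⟨w', hw'm, hw'⟩ := hw
  have hf' : Measurable f' := hf.stronglyMeasurable_mk.measurable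
  have hg' : Measurable g' := hg.stronglyMeasurable_mk.measurable
  let G : EuclideanSpace ℝ (Fin dr) → ℝ≥0 := fun y => ‖g' y‖₊ ^ ((s + 1) / s)
  have hG : Measurable G := hg'.nnnorm.pow_const _
  have hGe : ∀ y, (G y : ℝ≥0∞) = ‖g' y‖ₑ ^ ((s + 1) / s) := fun y => by
    simp only [G]
    rw [ENNReal.coe_rpow_of_nonneg _ hq0.le]
    rfl
  have hGs : ∀ y, (G y : ℝ≥0∞) ^ (s / (s + 1)) = ‖g' y‖ₑ := fun y => by
    rw [hGe, ← ENNReal.rpow_mul, show (s + 1) / s * (s / (s + 1)) = 1 by field_simp,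
      ENNReal.rpow_one]
  have hfn : eLpNorm f (ENNReal.ofReal p') volume = (∫⁻ x, ‖f' x‖ₑ ^ p') ^ (1 / p') := by
    rw [eLpNorm_congr_ae hf.ae_eq_mk, eLpNorm_eq_lintegral_rpow_enorm_toReal (by simpa using hp0)
      ENNReal.ofReal_ne_top, ENNReal.toReal_ofReal hp0.le]
  have hgn : eLpNorm g (ENNReal.ofReal ((s + 1) / s)) volume =
      (∫⁻ y, G y) ^ (s / (s + 1)) := by
    rw [eLpNorm_congr_ae hg.ae_eq_mk, eLpNorm_eq_lintegral_rpow_enorm_toReal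
      (by simpa using hq0) ENNReal.ofReal_ne_top, ENNReal.toReal_ofReal hq0.le, one_div_div]
    simp_rw [hGe]
    rfl
  have hmain := lintegral_weight_mul_le hdl hU hρ Set.inter_subset_left hEm hw'm
    hw' hs hp' hK hN hf'.enorm hG
  rw [hfn, hgn]
  refine le_trans (le_of_eq ?_) (hmain.trans (le_of_eq ?_))
  · have hfz : ∀ᵐ z : EuclideanSpace ℝ (Fin dl) × EuclideanSpace ℝ (Fin dr), f z.1 = f' z.1 :=
      Measure.quasiMeasurePreserving_fst.ae_eq_comp hf.ae_eq_mk
    have hgz : ∀ᵐ z : EuclideanSpace ℝ (Fin dl) × EuclideanSpace ℝ (Fin dr), g z.2 = g' z.2 :=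
      Measure.quasiMeasurePreserving_snd.ae_eq_comp hg.ae_eq_mk
    have hwz : ∀ᵐ z : EuclideanSpace ℝ (Fin dl) × EuclideanSpace ℝ (Fin dr), z ∈ U → w z = w' z :=
      (ae_restrict_iff' hU.measurableSet).1 hw'
    have hWm : Measurable ((U ∩ F).indicator fun z => ‖w' z‖ₑ) :=
      hw'm.enorm.indicator hEm
    rw [← lintegral_indicator hEm]
    calc _ = ∫⁻ z : EuclideanSpace ℝ (Fin dl) × EuclideanSpace ℝ (Fin dr),
          ‖f' z.1‖ₑ * ((U ∩ F).indicator (fun z => ‖w' z‖ₑ) z ^ (1 / (s + 1)) *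
            (G z.2 : ℝ≥0∞) ^ (s / (s + 1))) := by
          refine lintegral_congr_ae ?_
          filter_upwards [hfz, hgz, hwz] with z h1 h2 h3
          by_cases hz : z ∈ U ∩ F
          · rw [Set.indicator_of_mem hz, Set.indicator_of_mem hz, h1, h2, h3 hz.1, hGs, enorm_mul]
            ring
          · rw [Set.indicator_of_notMem hz, Set.indicator_of_notMem hz,
              ENNReal.zero_rpow_of_pos (by positivity), zero_mul, mul_zero]
      _ = _ := by
          rw [Measure.volume_eq_prod, lintegral_prod]
          · refine lintegral_congr fun x => ?_
            exact lintegral_const_mul' ‖f' x‖ₑ _ enorm_ne_top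
          · exact ((hf'.comp measurable_fst).enorm.mul ((hWm.pow_const _).mul
              ((hG.comp measurable_snd).coe_nnreal_ennreal.pow_const _))).aemeasurable
  · push_cast
    rfl
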